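/- For $n\ge 0$ let $M^n$ be the complex vector space with basis the words $w=w_1\cdots w_n$ of length $n$ in the letters $1,\dots,n$, a module over $\mathbb{C}[S_n]$ by place permutations: $\sigma(w)=w_{\sigma^{-1}(1)}\cdots w_{\sigma^{-1}(n)}$. Let $$Q_n=\sum_{1\le i\le j\le n}\tfrac1j\,(i\,j)\in\mathbb{C}[S_n]\qquad\text{(with } (i\,i)=\mathrm{id}).$$ For a partition $\lambda$ of $n$, a Young tableau $T$ of shape $\lambda$ is a filling of the boxes of $\lambda$ with the numbers $1,\dots,n$, each used once; $w(T)$ is the word whose $k$-th letter is the row of $T$ containing $k$, and the Specht module $S^\lambda\subseteq M^n$ is the $\mathbb{C}[S_n]$-submodule spanned by the elements $s(T)=\sum_{\sigma}\operatorname{sgn}(\sigma)\,w(\sigma(T))$, where $T$ runs over the Young tableaux of shape $\lambda$ and $\sigma$ over the column stabilizer of $T$. For $1\le a\le n+1$ let $\Phi_a:M^n\to M^{n+1}$ be the linear map $w\mapsto w\cdot a$ appending the letter $a$. For a partition $\mu$ of $n+1$ let $\pi^\mu:M^{n+1}\to M^{n+1}$ be the $\mathbb{C}[S_{n+1}]$-linear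 projection onto the $S^\mu$-isotypic component. Theorem. Let $\lambda=(\lambda_1,\dots,\lambda_r)$ be a partition of $n\ge 0$ with $r$ nonzero parts, and put $\lambda_{r+1}=0$. Let $1\le a\le r+1$ and $1\le i\le a$ be such that $\mu=\lambda+e_i$ (a box added to $\lambda$ in row $i$) is a partition of $n+1$. Then the lifting operator $\kappa_a^{\lambda,\mu}=\pi^\mu\circ\Phi_a|_{S^\lambda}$ on $S^\lambda$ satisfies $$Q_{n+1}\circ\kappa_a^{\lambda,\mu}-\kappa_a^{\lambda,\mu}\circ Q_n=\frac{2+\lambda_i-i}{n+1}\,\kappa_a^{\lambda,\mu}.$$ In particular, if $v\in S^\lambda$ is an eigenvector of $Q_n$ with eigenvalue $\varepsilon$, then either $\kappa_a^{\lambda,\mu}(v)=0$ or $\kappa_a^{\lambda,\mu}(v)$ is an eigenvector of $Q_{n+1}$ with eigenvalue $$\varepsilon+\frac{2+\lambda_i-i}{n+1}.$$ -/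

import Mathlib

namespace OneSided

open Equiv

/-! ### Words and the place-permutation modules -/

/-- Words of length `n` in the alphabet `[n]`; positions and letters are indexed from `0`. -/
abbrev Word (n : ℕ) : Type := Fin n → Fin n

/-- The group algebra `ℂ[Sₙ]`. -/
abbrev GroupAlg (n : ℕ) : Type := MonoidAlgebra ℂ (Perm (Fin n))

/-- The representation of `Sₙ` on the complex space with basis the words of length `n`, by place
permutations: `σ(w) = w_{σ⁻¹(1)} ⋯ w_{σ⁻¹(n)}`. -/
noncomputable def wordRep (n : ℕ) : Representation ℂ (Perm (Fin n)) (Word n →₀ ℂ) where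
  toFun σ := Finsupp.lmapDomain ℂ ℂ (fun w : Word n => w ∘ ⇑σ⁻¹)
  map_one' := by
    ext w
    simp
  map_mul' σ τ := by
    refine Finsupp.lhom_ext fun w c => ?_
    simp [Module.End.mul_apply, Finsupp.mapDomain_single, Function.comp_assoc]

/-- `Mⁿ`, the complex space with basis the words of length `n`. -/
def WordModule (n : ℕ) : Type := Word n →₀ ℂ

noncomputable instance (n : ℕ) : AddCommGroup (WordModule n) :=
  inferInstanceAs (AddCommGroup (Word n →₀ ℂ))

noncomputable instance (n : ℕ) : Module ℂ (WordModule n) :=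
  inferInstanceAs (Module ℂ (Word n →₀ ℂ))

/-- `Mⁿ` is a module over `ℂ[Sₙ]` through the place permutations. -/
noncomputable instance (n : ℕ) : Module (GroupAlg n) (WordModule n) :=
  Module.compHom (Word n →₀ ℂ) (wordRep n).asAlgebraHom.toRingHom

instance (n : ℕ) : IsScalarTower ℂ (GroupAlg n) (WordModule n) where
  smul_assoc c x v := by
    change (wordRep n).asAlgebraHom (c • x) v = c • (wordRep n).asAlgebraHom x v
    rw [map_smul]
    rfl

/-- The basis vector of `Mⁿ` given by a word. -/
noncomputable def word {n : ℕ} (w : Word n) : WordModule n :=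
  (Finsupp.single w 1 : Word n →₀ ℂ)

/-! ### Partitions as tuples, tableaux, Specht modules -/

/-- An `n`-tuple of natural numbers is a partition of `n` (padded with zeros) if it is
non-increasing with sum `n`. -/
structure IsPartition {n : ℕ} (lam : Fin n → ℕ) : Prop where
  antitone : Antitone lam
  sum_eq : ∑ i, lam i = n

/-- The number of nonzero parts. -/
def length {n : ℕ} (lam : Fin n → ℕ) : ℕ := (Finset.univ.filter fun i => lam i ≠ 0).card

/-- The tuple with one more zero at the end. -/
def extend {n : ℕ} (lam : Fin n → ℕ) : Fin (n + 1) → ℕ := Fin.snoc (α := fun _ => ℕ) lam 0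

/-- `λ + eᵢ`: add a zero at the end, then add `1` in position `i`. -/
def addBox {n : ℕ} (lam : Fin n → ℕ) (i : Fin (n + 1)) : Fin (n + 1) → ℕ :=
  extend lam + Pi.single i 1

/-- Young tableaux of shape `lam`: bijective fillings with the numbers `1, …, n` (indexed from `0`)
of the boxes `(i, j)`, where `i` is a row and `j < lam i` is a column. -/
abbrev Tableau {n : ℕ} (lam : Fin n → ℕ) : Type := (Σ i : Fin n, Fin (lam i)) ≃ Fin n

namespace Tableau

variable {n : ℕ} {lam : Fin n → ℕ}

/-- The row of the box that contains the entry `k`. -/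
def row (T : Tableau lam) (k : Fin n) : Fin n := (T.symm k).1

/-- The column of the box that contains the entry `k`. -/
def col (T : Tableau lam) (k : Fin n) : ℕ := (T.symm k).2

/-- `σ(T)`, the tableau with every entry `k` replaced by `σ(k)`. -/
def perm (σ : Perm (Fin n)) (T : Tableau lam) : Tableau lam := T.trans σ

/-- The word `w(T)`: its `k`-th letter is the row of the entry `k`. -/
def toWord (T : Tableau lam) : Word n := T.row

/-- The column stabilizer of `T`. -/
def colStab (T : Tableau lam) : Finset (Perm (Fin n)) :=
  Finset.univ.filter fun σ => ∀ k, T.col (σ k) = T.col k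

/-- The polytabloid `s(T) = ∑ sign(σ) w(σ(T))`, summed over the column stabilizer of `T`. -/
noncomputable def polytabloid (T : Tableau lam) : WordModule n :=
  ∑ σ ∈ T.colStab, ((Perm.sign σ : ℤ) : ℂ) • word (perm σ T).toWord

end Tableau

/-- The Specht module `S^λ` inside `Mⁿ`, spanned by the polytabloids of shape `lam`. -/
noncomputable def specht {n : ℕ} (lam : Fin n → ℕ) : Submodule (GroupAlg n) (WordModule n) :=
  Submodule.span (GroupAlg n) (Set.range fun T : Tableau lam => T.polytabloid)

/-! ### Isotypic projections -/

section Isotypic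

variable (R M S : Type*) [Ring R] [AddCommGroup M] [Module R M] [AddCommGroup S] [Module R S]

/-- `p` is an `R`-linear projection of `M` onto its `S`-isotypic component. -/
structure IsIsotypicProj (p : M →ₗ[R] M) : Prop where
  range_eq : LinearMap.range p = isotypicComponent R M S
  apply_eq : ∀ x ∈ isotypicComponent R M S, p x = x

theorem exists_isIsotypicProj [IsSemisimpleModule R M] :
    ∃ p : M →ₗ[R] M, IsIsotypicProj R M S p := by
  obtain ⟨q, hq⟩ := exists_isCompl (isotypicComponent R M S)
  refine ⟨Submodule.projection _ _ hq, ?_, ?_⟩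
  · simp
  · intro x hx
    exact Submodule.projection_apply_left hq ⟨x, hx⟩

/-- The isotypic projection of a semisimple module `M` onto its `S`-isotypic component. For simple
`S` it is the only projection onto that component, see `IsIsotypicProj.eq`. -/
noncomputable def isotypicProj [IsSemisimpleModule R M] : M →ₗ[R] M :=
  Classical.choose (exists_isIsotypicProj R M S)

theorem isotypicProj_spec [IsSemisimpleModule R M] :
    IsIsotypicProj R M S (isotypicProj R M S) :=
  Classical.choose_spec (exists_isIsotypicProj R M S)

variable {R M S}

theorem IsIsotypicProj.eq [IsSemisimpleModule R M] [IsSimpleModule R S] {p q : M →ₗ[R] M}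
    (hp : IsIsotypicProj R M S p) (hq : IsIsotypicProj R M S q) : p = q := by
  have key : ∀ x ∈ LinearMap.ker p, q x = 0 := by
    suffices h : LinearMap.ker p ≤ LinearMap.ker q from fun x hx => h hx
    rw [← IsSemisimpleModule.sSup_simples_le (LinearMap.ker p)]
    refine sSup_le fun m hm => ?_
    obtain ⟨hms, hmp⟩ := hm
    have := hms
    rcases (q ∘ₗ m.subtype).injective_or_eq_zero with hinj | hzero
    · exfalso
      let e := LinearEquiv.ofInjective _ hinj
      have : IsSimpleModule R (LinearMap.range (q ∘ₗ m.subtype)) := IsSimpleModule.congr e.symm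
      have hle : LinearMap.range (q ∘ₗ m.subtype) ≤ isotypicComponent R M S := by
        rw [← hq.range_eq]
        exact LinearMap.range_comp_le_range _ _
      obtain ⟨e'⟩ := isIsotypicOfType_submodule_iff.mp
        (IsIsotypicOfType.isotypicComponent R M S) _ hle
      have hmN : m ≤ isotypicComponent R M S := le_sSup ⟨e.trans e'⟩
      have hbot : m = ⊥ := by
        rw [eq_bot_iff]
        intro x hx
        have h0 : p x = 0 := hmp hx
        rw [hp.apply_eq x (hmN hx)] at h0
        simpa using h0
      exact (isSimpleModule_iff_isAtom.mp hms).1 hbot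
    · intro x hx
      exact LinearMap.congr_fun hzero ⟨x, hx⟩
  ext x
  have hpx : p x ∈ isotypicComponent R M S := hp.range_eq ▸ LinearMap.mem_range_self p x
  have h := key (x - p x) (by simp [hp.apply_eq _ hpx])
  rw [map_sub, hq.apply_eq _ hpx, sub_eq_zero] at h
  exact h.symm

end Isotypic

/-! ### The shuffle and the lifting operators -/

/-- The scaled one-sided transposition shuffle `Qₙ = ∑_{1 ≤ i ≤ j ≤ n} (1/j) (i j)` in `ℂ[Sₙ]`
(with `(i i)` the identity); the index `j : Fin n` stands for the number `j + 1`. -/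
noncomputable def Q (n : ℕ) : GroupAlg n :=
  ∑ j : Fin n, ∑ i ∈ Finset.Iic j, MonoidAlgebra.single (swap i j) (1 / ((j : ℂ) + 1))

/-- The action of `Qₙ` on a `ℂ[Sₙ]`-module. -/
noncomputable def shuffle (n : ℕ) (V : Type*) [AddCommGroup V] [Module ℂ V] [Module (GroupAlg n) V]
    [IsScalarTower ℂ (GroupAlg n) V] : Module.End ℂ V :=
  Algebra.lsmul ℂ ℂ V (Q n)

/-- `w · a`: append the letter `a` to the word `w`. -/
def appendLetter {n : ℕ} (a : Fin (n + 1)) (w : Word n) : Word (n + 1) :=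
  Fin.snoc (α := fun _ => Fin (n + 1)) (fun k => (w k).castSucc) a

/-- The adding operator `Φₐ : Mⁿ → Mⁿ⁺¹`, `w ↦ w · a`. -/
noncomputable def Phi {n : ℕ} (a : Fin (n + 1)) : WordModule n →ₗ[ℂ] WordModule (n + 1) :=
  (Finsupp.lmapDomain ℂ ℂ (appendLetter a) : (Word n →₀ ℂ) →ₗ[ℂ] (Word (n + 1) →₀ ℂ))

/-- The lifting operator `κₐ^{λ,μ} = π^μ ∘ Φₐ` on `S^λ`, where `π^μ` is the projection of `Mⁿ⁺¹`
onto its `S^μ`-isotypic component. -/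
noncomputable def kappa {n : ℕ} (a : Fin (n + 1)) (lam : Fin n → ℕ) (mu : Fin (n + 1) → ℕ) :
    specht lam →ₗ[ℂ] WordModule (n + 1) :=
  (isotypicProj (GroupAlg (n + 1)) (WordModule (n + 1)) (specht mu)).restrictScalars ℂ ∘ₗ
    Phi a ∘ₗ (specht lam).subtype.restrictScalars ℂ

end OneSided

namespace OneSided

open Equiv

/-! ### The action on words -/

/-! Let `J` be `lastSwapSum n` and `Z` the central element `swapSum`. Since `Phi a` commutes with
permutations of the first `n` positions, passing from `n` to `n + 1` changes `Q` by `J / (n + 1)`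
and `Z` by `2 J - 1` (`Phi_Q_smul`, `Phi_swapSum_smul`). So it suffices to know how `J` acts between
`S^λ` and the `S^μ`-isotypic component, and there `Z` acts by the scalars `swapScalar` of `λ` and of
`μ`. These are computed on polytabloids (`Tableau.colAntisymm_smul_swap`), and adding a box raises
the scalar by twice its content plus one (`swapScalar_addBox`). Hence after projection `J` acts as
the content plus one. -/

theorem single_smul_word {n : ℕ} (σ : Perm (Fin n)) (c : ℂ) (w : Word n) :
    (MonoidAlgebra.single σ c : GroupAlg n) • word w = c • word (w ∘ ⇑σ⁻¹) := by
  change (wordRep n).asAlgebraHom (MonoidAlgebra.single σ c) (Finsupp.single w 1) = _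
  rw [Representation.asAlgebraHom_single]
  change c • Finsupp.mapDomain _ (Finsupp.single w 1) = _
  rw [Finsupp.mapDomain_single]
  rfl

theorem linearMap_ext_word {n : ℕ} {V : Type*} [AddCommGroup V] [Module ℂ V]
    {f g : WordModule n →ₗ[ℂ] V} (h : ∀ w : Word n, f (word w) = g (word w)) : f = g :=
  Finsupp.lhom_ext' (M := ℂ) (N := V) fun w => LinearMap.ext_ring (h w)

theorem Phi_word {n : ℕ} (a : Fin (n + 1)) (w : Word n) :
    Phi a (word w) = word (appendLetter a w) := by
  change Finsupp.mapDomain _ (Finsupp.single w 1) = _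
  rw [Finsupp.mapDomain_single]
  rfl

theorem swap_castSucc_apply {n : ℕ} (i j k : Fin n) :
    swap i.castSucc j.castSucc k.castSucc = (swap i j k).castSucc := by
  simp only [swap_apply_def, Fin.castSucc_inj]
  split_ifs <;> rfl

theorem appendLetter_comp_swap {n : ℕ} (a : Fin (n + 1)) (w : Word n) (i j : Fin n) :
    appendLetter a w ∘ swap i.castSucc j.castSucc = appendLetter a (w ∘ swap i j) := by
  funext k
  refine Fin.lastCases ?_ (fun k => ?_) k
  · simp [appendLetter, swap_apply_of_ne_of_ne, (Fin.castSucc_lt_last _).ne']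
  · simp [appendLetter, swap_castSucc_apply]

theorem Phi_swap_smul {n : ℕ} (a : Fin (n + 1)) (i j : Fin n) (c : ℂ) (v : WordModule n) :
    Phi a ((MonoidAlgebra.single (swap i j) c : GroupAlg n) • v) =
      (MonoidAlgebra.single (swap i.castSucc j.castSucc) c : GroupAlg (n + 1)) • Phi a v := by
  have h : Phi a ∘ₗ Algebra.lsmul ℂ ℂ (WordModule n)
        (MonoidAlgebra.single (swap i j) c : GroupAlg n) =
      Algebra.lsmul ℂ ℂ (WordModule (n + 1))
        (MonoidAlgebra.single (swap i.castSucc j.castSucc) c : GroupAlg (n + 1)) ∘ₗ Phi a := by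
    refine linearMap_ext_word fun w => ?_
    simp [single_smul_word, Phi_word, appendLetter_comp_swap]
  exact LinearMap.congr_fun h v

/-! ### Sums of transpositions -/

/-- The sum of `(k l)` over all ordered pairs, including the identities `(k k)`. -/
noncomputable def swapSum (n : ℕ) : GroupAlg n :=
  ∑ k : Fin n, ∑ l : Fin n, MonoidAlgebra.single (swap k l) 1

/-- The sum of the `(k n)` over all `k`, for the last position `n`. -/
noncomputable def lastSwapSum (n : ℕ) : GroupAlg (n + 1) :=
  ∑ k : Fin (n + 1), MonoidAlgebra.single (swap k (Fin.last n)) 1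

/-- Conjugation by `σ` permutes the ordered pairs `(k, l)`. -/
theorem swapSum_mul_single {n : ℕ} (σ : Perm (Fin n)) (c : ℂ) :
    swapSum n * MonoidAlgebra.single σ c = MonoidAlgebra.single σ c * swapSum n := by
  simp only [swapSum, Finset.sum_mul, Finset.mul_sum, MonoidAlgebra.single_mul_single, one_mul,
    mul_one]
  rw [← Equiv.sum_comp σ]
  refine Finset.sum_congr rfl fun k _ => ?_
  rw [← Equiv.sum_comp σ]
  refine Finset.sum_congr rfl fun l _ => ?_
  rw [Equiv.mul_swap_eq_swap_mul]

theorem swapSum_mul_comm {n : ℕ} (x : GroupAlg n) : swapSum n * x = x * swapSum n := by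
  induction x using MonoidAlgebra.induction_linear with
  | zero => simp
  | add x y hx hy => rw [mul_add, add_mul, hx, hy]
  | single σ c => exact swapSum_mul_single σ c

theorem swapSum_smul_comm {n : ℕ} {V : Type*} [AddCommGroup V] [Module (GroupAlg n) V]
    (x : GroupAlg n) (v : V) : swapSum n • x • v = x • swapSum n • v := by
  rw [← mul_smul, swapSum_mul_comm, mul_smul]

theorem Phi_swapSum_smul {n : ℕ} (a : Fin (n + 1)) (v : WordModule n) :
    Phi a (swapSum n • v) =
      swapSum (n + 1) • Phi a v - (2 : ℂ) • lastSwapSum n • Phi a v + Phi a v := by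
  -- Ordered pairs meet the last position in both orders; doubling `lastSwapSum` counts the identity
  -- `(last last)` once too often.
  have h : swapSum (n + 1) =
      ∑ k : Fin n, ∑ l : Fin n, MonoidAlgebra.single (swap k.castSucc l.castSucc) 1
        + (2 : ℂ) • lastSwapSum n - 1 := by
    simp only [swapSum, lastSwapSum, Fin.sum_univ_castSucc, Finset.sum_add_distrib, swap_self,
      two_smul, swap_comm (Fin.last n)]
    rw [← Perm.one_def, ← MonoidAlgebra.one_def]
    abel
  rw [h, sub_smul, add_smul, one_smul, smul_assoc]
  simp only [swapSum, Finset.sum_smul, map_sum, Phi_swap_smul]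
  abel

theorem Phi_Q_smul {n : ℕ} (a : Fin (n + 1)) (v : WordModule n) :
    Phi a (Q n • v) =
      Q (n + 1) • Phi a v - (1 / ((n : ℂ) + 1)) • lastSwapSum n • Phi a v := by
  -- The new terms are those whose larger index is the last position, all of weight `1 / (n + 1)`.
  have h : Q (n + 1) = ∑ j : Fin n, ∑ i ∈ Finset.Iic j,
        MonoidAlgebra.single (swap i.castSucc j.castSucc) (1 / ((j : ℂ) + 1))
        + (1 / ((n : ℂ) + 1)) • lastSwapSum n := by
    rw [Q, Fin.sum_univ_castSucc]
    congr 1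
    · refine Finset.sum_congr rfl fun j _ => ?_
      rw [Fin.val_castSucc, ← Fin.map_castSuccEmb_Iic, Finset.sum_map]
      rfl
    · rw [show Finset.Iic (Fin.last n) = Finset.univ from Finset.Iic_top, lastSwapSum,
        Finset.smul_sum]
      simp
  rw [h, add_smul, smul_assoc]
  simp only [Q, Finset.sum_smul, map_sum, Phi_swap_smul]
  abel

/-! ### Column antisymmetrizers -/

namespace Tableau

variable {n : ℕ} {lam : Fin n → ℕ}

theorem row_apply (T : Tableau lam) (b : Σ i : Fin n, Fin (lam i)) : T.row (T b) = b.1 := by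
  rw [row, Equiv.symm_apply_apply]

theorem col_apply (T : Tableau lam) (b : Σ i : Fin n, Fin (lam i)) : T.col (T b) = b.2 := by
  rw [col, Equiv.symm_apply_apply]

theorem ext_row_col (T : Tableau lam) {k l : Fin n} (hr : T.row k = T.row l)
    (hc : T.col k = T.col l) : k = l := by
  apply T.symm.injective
  unfold row at hr
  unfold col at hc
  generalize T.symm k = b at *
  generalize T.symm l = b' at *
  obtain ⟨p, x⟩ := b
  obtain ⟨q, y⟩ := b'
  obtain rfl : p = q := hr
  obtain rfl : x = y := Fin.ext hc
  rfl

/-- The signed sum of the column stabilizer. -/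
noncomputable def colAntisymm (T : Tableau lam) : GroupAlg n :=
  ∑ σ ∈ T.colStab, MonoidAlgebra.single σ ((Perm.sign σ : ℤ) : ℂ)

theorem mem_colStab {T : Tableau lam} {σ : Perm (Fin n)} :
    σ ∈ T.colStab ↔ ∀ k, T.col (σ k) = T.col k := by
  simp [colStab]

theorem swap_mem_colStab {T : Tableau lam} {k l : Fin n} (h : T.col k = T.col l) :
    swap k l ∈ T.colStab := by
  rw [mem_colStab]
  intro m
  rw [swap_apply_def]
  split_ifs with h1 h2
  · rw [h1, h]
  · rw [h2, h]
  · rfl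

theorem polytabloid_eq (T : Tableau lam) : T.polytabloid = T.colAntisymm • word T.toWord := by
  rw [polytabloid, colAntisymm, Finset.sum_smul]
  refine Finset.sum_congr rfl fun σ _ => ?_
  rw [single_smul_word]
  rfl

theorem colAntisymm_mul_swap (T : Tableau lam) {k l : Fin n} (hkl : k ≠ l)
    (h : T.col k = T.col l) :
    T.colAntisymm * MonoidAlgebra.single (swap k l) 1 = -T.colAntisymm := by
  have hs := mem_colStab.1 (swap_mem_colStab h)
  rw [colAntisymm, Finset.sum_mul, ← Finset.sum_neg_distrib]
  refine Finset.sum_bij' (fun σ _ => σ * swap k l) (fun σ _ => σ * swap k l) ?_ ?_ ?_ ?_ ?_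
  · intro σ hσ
    rw [mem_colStab] at hσ ⊢
    intro m
    rw [Perm.mul_apply, hσ, hs]
  · intro σ hσ
    rw [mem_colStab] at hσ ⊢
    intro m
    rw [Perm.mul_apply, hσ, hs]
  · intro σ _
    simp [mul_assoc]
  · intro σ _
    simp [mul_assoc]
  · intro σ _
    rw [MonoidAlgebra.single_mul_single, ← MonoidAlgebra.single_neg]
    simp [Perm.sign_swap hkl]

/-- The swap fixes the word but negates the antisymmetrizer. -/
theorem colAntisymm_smul_eq_zero (T : Tableau lam) {k l : Fin n} (hkl : k ≠ l)
    (h : T.col k = T.col l) {w : Word n} (hw : w k = w l) : T.colAntisymm • word w = 0 := by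
  have hfix : (MonoidAlgebra.single (swap k l) 1 : GroupAlg n) • word w = word w := by
    rw [single_smul_word, one_smul, swap_inv]
    congr 1
    funext m
    rw [Function.comp_apply, swap_apply_def]
    split_ifs with h1 h2
    · rw [h1, hw]
    · rw [h2, hw]
    · rfl
  have hneg : T.colAntisymm • word w = -(T.colAntisymm • word w) := by
    conv_lhs => rw [← hfix, ← mul_smul, colAntisymm_mul_swap T hkl h, neg_smul]
  have h2 : (2 : ℂ) • (T.colAntisymm • word w) = 0 := by
    rw [two_smul]
    nth_rewrite 1 [hneg]
    exact neg_add_cancel _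
  exact (smul_eq_zero.1 h2).resolve_left two_ne_zero

theorem colAntisymm_smul_swap_of_row_lt (T : Tableau lam) (hlam : Antitone lam) {k l : Fin n}
    (hr : T.row k < T.row l) (hc : T.col k ≠ T.col l) :
    T.colAntisymm • word (T.toWord ∘ swap k l) = 0 := by
  have hlt : T.col l < lam (T.row k) := lt_of_lt_of_le (T.symm l).2.isLt (hlam hr.le)
  -- This box lies in the column of `l` and the row of `k`; after the swap, positions `m` and `l`
  -- carry the same letter.
  set m : Fin n := T ⟨T.row k, ⟨T.col l, hlt⟩⟩
  have hmr : T.row m = T.row k := T.row_apply _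
  have hmc : T.col m = T.col l := T.col_apply _
  have hml : m ≠ l := fun e => hr.ne (by rw [← hmr, e])
  have hmk : m ≠ k := fun e => hc (by rw [← hmc, e])
  refine T.colAntisymm_smul_eq_zero hml hmc ?_
  simp [swap_apply_of_ne_of_ne hmk hml, toWord, hmr]

/-- A swap within a row fixes the word, one within a column gives a sign, and any other kills the
term. For `k = l` the coefficient is `1 - 1 + 1`. -/
theorem colAntisymm_smul_swap (T : Tableau lam) (hlam : Antitone lam) (k l : Fin n) :
    T.colAntisymm • word (T.toWord ∘ swap k l) =
      ((if T.row k = T.row l then 1 else 0) - (if T.col k = T.col l then 1 else 0) +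
        (if k = l then 1 else 0) : ℂ) • T.polytabloid := by
  rcases eq_or_ne k l with rfl | hkl
  · simp [polytabloid_eq, swap_self]
  by_cases hr : T.row k = T.row l
  · have hc : T.col k ≠ T.col l := fun h => hkl (T.ext_row_col hr h)
    have hw : T.toWord ∘ swap k l = T.toWord := by
      funext m
      rw [Function.comp_apply, swap_apply_def]
      split_ifs with h1 h2
      · rw [h1]; exact hr.symm
      · rw [h2]; exact hr
      · rfl
    simp [hw, hr, hc, hkl, polytabloid_eq]
  by_cases hc : T.col k = T.col l
  · have h1 : word (T.toWord ∘ swap k l) =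
        (MonoidAlgebra.single (swap k l) 1 : GroupAlg n) • word T.toWord := by
      rw [single_smul_word, one_smul, swap_inv]
    rw [h1, ← mul_smul, colAntisymm_mul_swap T hkl hc]
    simp [hr, hc, hkl, polytabloid_eq]
  · simp only [hr, hc, hkl, if_false, sub_zero, add_zero, zero_smul]
    rcases lt_or_gt_of_ne hr with h | h
    · exact T.colAntisymm_smul_swap_of_row_lt hlam h hc
    · rw [swap_comm]
      exact T.colAntisymm_smul_swap_of_row_lt hlam h (Ne.symm hc)

end Tableau

/-! ### The scalar by which the sum of transpositions acts on a Specht module -/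

/-- The scalar by which `swapSum n` acts on `S^λ`: the number of ordered pairs of boxes in a common
row, minus that of pairs in a common column, plus the number of boxes. -/
def swapScalar {n : ℕ} (lam : Fin n → ℕ) : ℂ :=
  ∑ p, (lam p : ℂ) ^ 2 - ∑ p, ∑ q, ((min (lam p) (lam q) : ℕ) : ℂ) + n

/-- Rows of lengths `a` and `b` share `min a b` columns. -/
theorem sum_ite_val_eq (a b : ℕ) :
    ∑ x : Fin a, ∑ y : Fin b, (if (x : ℕ) = y then (1 : ℂ) else 0) = (min a b : ℕ) := by
  rw [Fin.sum_univ_eq_sum_range (fun x => ∑ y : Fin b, if x = (y : ℕ) then (1 : ℂ) else 0) a]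
  have h (x : ℕ) : ∑ y : Fin b, (if x = (y : ℕ) then (1 : ℂ) else 0) = if x < b then 1 else 0 := by
    rw [Fin.sum_univ_eq_sum_range (fun y => if x = y then (1 : ℂ) else 0) b]
    simp
  simp only [h]
  rw [Finset.sum_boole]
  congr 1
  rw [← Finset.card_range (min a b)]
  congr 1
  ext x
  simp

theorem Tableau.sum_swap_coeff {n : ℕ} {lam : Fin n → ℕ} (T : Tableau lam) :
    ∑ k, ∑ l, ((if T.row k = T.row l then 1 else 0) - (if T.col k = T.col l then 1 else 0) +
        (if k = l then 1 else 0) : ℂ) = swapScalar lam := by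
  have hT (f : Fin n → Fin n → ℂ) : ∑ k, ∑ l, f k l =
      ∑ p, ∑ x : Fin (lam p), ∑ q, ∑ y : Fin (lam q), f (T ⟨p, x⟩) (T ⟨q, y⟩) := by
    rw [← Equiv.sum_comp T, Fintype.sum_sigma]
    refine Finset.sum_congr rfl fun p _ => Finset.sum_congr rfl fun x _ => ?_
    rw [← Equiv.sum_comp T, Fintype.sum_sigma]
  simp only [Finset.sum_add_distrib, Finset.sum_sub_distrib, swapScalar]
  congr 1
  · rw [hT, hT]
    simp only [Tableau.row_apply, Tableau.col_apply]
    congr 1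
    · simp [pow_two]
    · refine Finset.sum_congr rfl fun p _ => ?_
      rw [Finset.sum_comm]
      exact Finset.sum_congr rfl fun q _ => sum_ite_val_eq _ _
  · simp

theorem Tableau.swapSum_smul_polytabloid {n : ℕ} {lam : Fin n → ℕ} (T : Tableau lam)
    (hlam : Antitone lam) : swapSum n • T.polytabloid = swapScalar lam • T.polytabloid := by
  -- Centrality lets the swaps act on the word before the antisymmetrizer does.
  rw [← T.sum_swap_coeff, T.polytabloid_eq, swapSum_smul_comm, swapSum]
  simp only [Finset.sum_smul, Finset.smul_sum]
  refine Finset.sum_congr rfl fun k _ => Finset.sum_congr rfl fun l _ => ?_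
  rw [single_smul_word, one_smul, swap_inv, T.colAntisymm_smul_swap hlam, ← T.polytabloid_eq]

theorem swapSum_smul_of_mem_specht {n : ℕ} {lam : Fin n → ℕ} (hlam : Antitone lam)
    {v : WordModule n} (hv : v ∈ specht lam) : swapSum n • v = swapScalar lam • v := by
  induction hv using Submodule.span_induction with
  | mem x hx =>
    obtain ⟨T, rfl⟩ := hx
    exact T.swapSum_smul_polytabloid hlam
  | zero => simp
  | add x y _ _ hx hy => rw [smul_add, smul_add, hx, hy]
  | smul r x _ hx => rw [swapSum_smul_comm, hx, smul_algebra_smul_comm]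

theorem swapSum_smul_of_mem_isotypicComponent {n : ℕ} {lam : Fin n → ℕ} (hlam : Antitone lam)
    {v : WordModule n}
    (hv : v ∈ isotypicComponent (GroupAlg n) (WordModule n) (specht lam)) :
    swapSum n • v = swapScalar lam • v := by
  rw [isotypicComponent, sSup_eq_iSup'] at hv
  induction hv using Submodule.iSup_induction' with
  | mem N x hx =>
    obtain ⟨N, ⟨e⟩⟩ := N
    -- The scalar is put inside the group algebra so that the linearity of `e` applies to it.
    have h : swapSum n • e ⟨x, hx⟩ = (algebraMap ℂ (GroupAlg n) (swapScalar lam)) • e ⟨x, hx⟩ := by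
      rw [algebraMap_smul]
      exact Subtype.ext (swapSum_smul_of_mem_specht hlam (e ⟨x, hx⟩).2)
    rw [← map_smul, ← map_smul] at h
    have h' := congrArg Subtype.val (e.injective h)
    rwa [Submodule.coe_smul, Submodule.coe_smul, algebraMap_smul] at h'
  | zero => simp
  | add x y _ _ hx hy => rw [smul_add, smul_add, hx, hy]

/-! ### Adding a box -/

theorem sum_extend {n : ℕ} (lam : Fin n → ℕ) (f : ℕ → ℂ) :
    ∑ p, f (extend lam p) = ∑ p, f (lam p) + f 0 := by
  simp [Fin.sum_univ_castSucc, extend]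

/-- The empty row affects only the summand `n`. -/
theorem swapScalar_extend {n : ℕ} (lam : Fin n → ℕ) :
    swapScalar (extend lam) = swapScalar lam + 1 := by
  simp only [swapScalar, sum_extend lam fun x => (x : ℂ) ^ 2,
    fun p => sum_extend lam fun x => ((min (extend lam p) x : ℕ) : ℂ),
    sum_extend lam fun y => ∑ p, ((min y (lam p) : ℕ) : ℂ) + ((min y 0 : ℕ) : ℂ)]
  simp
  ring

theorem antitone_extend {n : ℕ} {lam : Fin n → ℕ} (hlam : Antitone lam) :
    Antitone (extend lam) := by
  intro p q
  refine Fin.lastCases (fun _ => by simp [extend]) (fun q => ?_) q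
  refine Fin.lastCases (fun h => ?_) (fun p h => ?_) p
  · exact absurd h (Fin.castSucc_lt_last q).not_ge
  · simpa [extend] using hlam (Fin.castSucc_le_castSucc_iff.1 h)

theorem swapScalar_add_single {m : ℕ} {nu mu : Fin m → ℕ} (i : Fin m) (hnu : Antitone nu)
    (hmu : Antitone mu) (hval : ∀ p, mu p = nu p + if p = i then 1 else 0) :
    swapScalar mu = swapScalar nu + 2 * nu i - 2 * i := by
  have hsq : ∑ p, (mu p : ℂ) ^ 2 = ∑ p, (nu p : ℂ) ^ 2 + (2 * nu i + 1) := by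
    have h (p : Fin m) : (mu p : ℂ) ^ 2 =
        (nu p : ℂ) ^ 2 + if p = i then 2 * (nu i : ℂ) + 1 else 0 := by
      rw [hval]
      split_ifs with h
      · subst h; push_cast; ring
      · simp
    simp [h, Finset.sum_add_distrib]
  -- Rows above the new box already reach its column, so each `min` with row `i` grows by one; both
  -- orders and the diagonal give `2 * i + 1`.
  have hgt {p : Fin m} (hp : p < i) : nu i + 1 ≤ nu p := by
    have := hmu hp.le
    simpa [hval, hp.ne] using this
  have hmin : ∑ p, ∑ q, ((min (mu p) (mu q) : ℕ) : ℂ) =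
      ∑ p, ∑ q, ((min (nu p) (nu q) : ℕ) : ℂ) + (2 * i + 1) := by
    have h (p q : Fin m) :
        ((min (mu p) (mu q) : ℕ) : ℂ) =
          ((min (nu p) (nu q) : ℕ) : ℂ) + ((if p = i then if q < i then 1 else 0 else 0) +
            (if q = i then if p < i then 1 else 0 else 0) +
            (if p = i then if q = i then 1 else 0 else 0)) := by
      rw [hval, hval]
      have key : min (nu p + if p = i then 1 else 0) (nu q + if q = i then 1 else 0) =
          min (nu p) (nu q) + ((if p = i then if q < i then 1 else 0 else 0) +
            (if q = i then if p < i then 1 else 0 else 0) +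
            (if p = i then if q = i then 1 else 0 else 0)) := by
        by_cases hp : p = i <;> by_cases hq : q = i
        · simp [hp, hq]
        · subst hp
          rcases lt_or_gt_of_ne hq with hlt | hlt
          · have := hgt hlt
            simp [hq, hlt]
            omega
          · have := hnu hlt.le
            simp [hq, hlt.not_gt]
            omega
        · subst hq
          rcases lt_or_gt_of_ne hp with hlt | hlt
          · have := hgt hlt
            simp [hp, hlt]
            omega
          · have := hnu hlt.le
            simp [hp, hlt.not_gt]
            omega
        · simp [hp, hq]
      rw [key]
      push_cast
      rfl
    have hlt : ∑ q : Fin m, (if q < i then (1 : ℂ) else 0) = i := by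
      rw [Finset.sum_boole, ← Fin.card_Iio i]
      congr 2
      ext q
      simp
    simp only [h, Finset.sum_add_distrib]
    rw [Finset.sum_comm (f := fun p q : Fin m => if q = i then if p < i then (1 : ℂ) else 0 else 0)]
    have hite (f : Fin m → ℂ) : ∑ p, ∑ q, (if p = i then f q else 0) = ∑ q, f q := by
      rw [Finset.sum_comm]
      simp
    rw [hite, hite, hlt]
    simp
    ring
  rw [swapScalar, hsq, hmin, swapScalar]
  ring

theorem swapScalar_addBox {n : ℕ} {lam : Fin n → ℕ} (hlam : Antitone lam) (i : Fin (n + 1))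
    (hmu : Antitone (addBox lam i)) :
    swapScalar (addBox lam i) = swapScalar lam + 2 * extend lam i - 2 * i + 1 := by
  rw [swapScalar_add_single i (antitone_extend hlam) hmu
    (fun p => by simp [addBox, Pi.single_apply]), swapScalar_extend]
  ring

/-! ### The lifting operators -/

theorem shuffle_kappa_sub {n : ℕ} {lam : Fin n → ℕ} (hlam : Antitone lam) (a i : Fin (n + 1))
    (hmu : Antitone (addBox lam i)) (v : specht lam) :
    shuffle (n + 1) (WordModule (n + 1)) (kappa a lam (addBox lam i) v)
        - kappa a lam (addBox lam i) (shuffle n (specht lam) v)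
      = ((2 + (extend lam i : ℂ) - ((i : ℂ) + 1)) / ((n : ℂ) + 1)) •
        kappa a lam (addBox lam i) v := by
  set p := isotypicProj (GroupAlg (n + 1)) (WordModule (n + 1)) (specht (addBox lam i)) with hp
  set x := Phi a (v : WordModule n) with hx
  have hk : kappa a lam (addBox lam i) v = p x := rfl
  have hkQ : kappa a lam (addBox lam i) (shuffle n (specht lam) v) =
      p (Phi a (Q n • (v : WordModule n))) := rfl
  have hQk : shuffle (n + 1) (WordModule (n + 1)) (p x) = p (Q (n + 1) • x) :=
    (map_smul p (Q (n + 1)) x).symm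
  have hsmul (c : ℂ) (y : WordModule (n + 1)) : p (c • y) = c • p y :=
    map_smul (p.restrictScalars ℂ) c y
  have hmem : p x ∈ isotypicComponent (GroupAlg (n + 1)) (WordModule (n + 1))
      (specht (addBox lam i)) := by
    rw [← (isotypicProj_spec (GroupAlg (n + 1)) (WordModule (n + 1))
      (specht (addBox lam i))).range_eq]
    exact LinearMap.mem_range_self p x
  have htop : p (swapSum (n + 1) • x) = swapScalar (addBox lam i) • p x := by
    rw [map_smul, swapSum_smul_of_mem_isotypicComponent hmu hmem]
  have hbot : swapScalar lam • x = swapSum (n + 1) • x - (2 : ℂ) • lastSwapSum n • x + x := by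
    rw [← Phi_swapSum_smul, swapSum_smul_of_mem_specht hlam v.2, map_smul]
  have hlast : (2 : ℂ) • p (lastSwapSum n • x) =
      (2 : ℂ) • (2 + (extend lam i : ℂ) - ((i : ℂ) + 1)) • p x := by
    -- Projecting turns `swapSum (n + 1)` into a scalar, so the relation can be solved for
    -- `lastSwapSum`. With `i` counted from zero, `(i : ℂ) + 1` is the usual row number.
    have h := congrArg p hbot
    rw [map_add, map_sub, hsmul, hsmul, htop, swapScalar_addBox hlam i hmu] at h
    have h' : (2 : ℂ) • p (lastSwapSum n • x) =
        (swapScalar lam + 2 * extend lam i - 2 * i + 1) • p x + p x - swapScalar lam • p x := by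
      rw [h]; abel
    rw [h']
    module
  rw [hkQ, hk, hQk, Phi_Q_smul, map_sub, hsmul, sub_sub_cancel,
    smul_right_injective _ (two_ne_zero' ℂ) hlast, smul_smul]
  congr 1
  ring

end OneSided

open OneSided in
theorem theoremA (n : ℕ) (lam : Fin n → ℕ) (hlam : IsPartition lam)
    (a i : Fin (n + 1)) (ha : (a : ℕ) ≤ length lam) (hi : i ≤ a)
    (mu : Fin (n + 1) → ℕ) (hmu : IsPartition mu) (hmu_eq : mu = addBox lam i) :
    shuffle (n + 1) (WordModule (n + 1)) ∘ₗ kappa a lam mu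
        - kappa a lam mu ∘ₗ shuffle n (specht lam)
      = ((2 + (extend lam i : ℂ) - ((i : ℂ) + 1)) / ((n : ℂ) + 1)) • kappa a lam mu ∧
    ∀ (v : specht lam) (ε : ℂ),
      Module.End.HasEigenvector (shuffle n (specht lam)) ε v →
      kappa a lam mu v = 0 ∨
        Module.End.HasEigenvector (shuffle (n + 1) (WordModule (n + 1)))
          (ε + (2 + (extend lam i : ℂ) - ((i : ℂ) + 1)) / ((n : ℂ) + 1)) (kappa a lam mu v) := by
  subst hmu_eq
  have key := shuffle_kappa_sub hlam.antitone a i hmu.antitone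
  refine ⟨LinearMap.ext key, fun v ε hv => or_iff_not_imp_left.2 fun h0 => ⟨?_, h0⟩⟩
  rw [Module.End.mem_eigenspace_iff, add_smul, ← key v, hv.apply_eq_smul, map_smul]
  abel
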